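/- Let $X$ be a finite set and let $F=F(X)$ be the free group with basis $X$, whose elements are identified with reduced words in $X\cup X^{-1}$; $|w|$ denotes the length of the reduced word $w$. For $R\subseteq F$ and $k\ge 0$ put $S_k=\{w\in F:|w|=k\}$ and $f_k(R)=|R\cap S_k|/|S_k|$. The set $R$ is called exponentially negligible in $F$ if there is a real $\delta$ with $0<\delta<1$ such that $f_k(R)<\delta^k$ for all sufficiently large $k$. Let $C$ be a finitely generated subgroup of infinite index in $F$. Let $S$ be a Schreier transversal of $C$, i.e. a subset of $F$ that contains exactly one element of each right coset $Cu$ ($u\in F$) and that contains every initial segment of each of its elements. Then: 1. the generalized normalizer $N^*_F(C)=\{f\in F: f^{-1}Cf\cap C\neq 1\}$ is exponentially negligible in $F$; 2. the set $S_{\rm sin}=S\cap N^*_F(C)$ of singular representatives is exponentially negligible in $F$; 3. the set $S_{\rm uns}=S\smallsetminus\{s\in S: sc\in S \text{ for all } c\in C\}$ of unstable representatives is exponentially negligible in $F$. -/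

import Mathlib

namespace FreeGroupDensity

variable {α : Type*} [DecidableEq α]

/-- The sphere of radius `k`: the elements of `F(α)` whose reduced word has length `k`. -/
def sphere (α : Type*) [DecidableEq α] (k : ℕ) : Set (FreeGroup α) :=
  {w | w.norm = k}

/-- Over a finite alphabet spheres are finite, so their `Set.ncard` is their true cardinality. -/
theorem sphere_finite [Finite α] (k : ℕ) : (sphere α k).Finite := by
  refine Set.Finite.of_finite_image (f := FreeGroup.toWord) ?_ FreeGroup.toWord_injective.injOn
  refine (List.finite_length_eq (α × Bool) k).subset ?_
  rintro _ ⟨w, hw, rfl⟩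
  exact hw

/-- The frequency `f_k(R) = |R ∩ S_k| / |S_k|` of a set `R` among the words of length `k`. -/
noncomputable def freq (R : Set (FreeGroup α)) (k : ℕ) : ℝ :=
  ((R ∩ sphere α k).ncard : ℝ) / ((sphere α k).ncard : ℝ)

/-- `R` is exponentially negligible: for some `0 < δ < 1`, `f_k(R) < δ ^ k` for all large `k`. -/
def ExponentiallyNegligible (R : Set (FreeGroup α)) : Prop :=
  ∃ δ : ℝ, 0 < δ ∧ δ < 1 ∧ ∀ᶠ k : ℕ in Filter.atTop, freq R k < δ ^ k

/-- The generalized normalizer `{f | f⁻¹ C f ∩ C ≠ 1}`. -/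
def generalizedNormalizer {G : Type*} [Group G] (C : Subgroup G) : Set G :=
  {f | C.map (MulAut.conj f⁻¹).toMonoidHom ⊓ C ≠ ⊥}

/-- `S` is a (right) Schreier transversal of `C`: it meets every right coset `C u` in exactly one
element (every element of `F` is uniquely `c * s` with `c ∈ C` and `s ∈ S`), and every initial segment (as reduced words) of an element of `S` belongs to `S`. -/
structure IsSchreierTransversal (C : Subgroup (FreeGroup α)) (S : Set (FreeGroup α)) : Prop where
  isComplement : Subgroup.IsComplement (C : Set (FreeGroup α)) S
  mem_of_prefix : ∀ s ∈ S, ∀ u : FreeGroup α, u.toWord <+: s.toWord → u ∈ S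

/-- The singular representatives: the elements of `S` in the generalized normalizer of `C`. -/
def singularReps {G : Type*} [Group G] (C : Subgroup G) (S : Set G) : Set G :=
  {s | s ∈ S ∧ s ∈ generalizedNormalizer C}

/-- The stable representatives: those `s ∈ S` with `s c ∈ S` for every `c ∈ C`. -/
def stableReps {G : Type*} [Group G] (C : Subgroup G) (S : Set G) : Set G :=
  {s | s ∈ S ∧ ∀ c ∈ C, s * c ∈ S}

/-- The unstable representatives: the elements of `S` which are not stable. -/
def unstableReps {G : Type*} [Group G] (C : Subgroup G) (S : Set G) : Set G :=
  S \ stableReps C S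

end FreeGroupDensity

namespace FreeGroupDensity

open FreeGroup

/-! ### Cancellation in products and initial segments of the elements of `C`. -/

section Words

variable {α : Type*} [DecidableEq α]

/-! Let `P` be the set of initial segments of elements of `C`. Cancellation arguments put both the
generalized normalizer and the unstable representatives inside the set of reduced products `u * v⁻¹`
with `u, v ∈ P` (`generalizedNormalizer_subset`, `unstableReps_subset`), so it suffices that this
set is negligible.

As `C` is finitely generated, `P` lies in finitely many cosets of `C`. As the index is infinite, B.
H. Neumann's covering lemma gives, for some `M`, an extension of length `M` leaving `P` from every
nontrivial point of `P` (`exists_uniform_extension_notMem`). With `q = 2|α| - 1`, `P` thus grows by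
a factor of at most `q ^ M - 1` every `M` steps, hence like `l ^ k` with `l < q`. The reduced
quotients of length `k` number at most a constant times `(k + 1) * l ^ k`, against at least `q ^ k`
words. Alphabets with at most one letter are separate: there `C` is trivial. -/

theorem toWord_mk_of_isReduced {L : List (α × Bool)} (h : IsReduced L) : (mk L).toWord = L := by
  rw [toWord_mk, h.reduce_eq]

theorem toWord_mk_of_prefix {L : List (α × Bool)} {w : FreeGroup α} (hp : L <+: w.toWord) :
    (mk L).toWord = L :=
  toWord_mk_of_isReduced (List.IsChain.prefix isReduced_toWord hp)

theorem exists_cancellation (L₁ L₂ : List (α × Bool)) (h₁ : IsReduced L₁) (h₂ : IsReduced L₂) :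
    ∃ a p b, L₁ = a ++ invRev p ∧ L₂ = p ++ b ∧ IsReduced (a ++ b) := by
  induction L₁ using List.reverseRecOn generalizing L₂ with
  | nil => exact ⟨[], [], L₂, by simp, by simp, by simpa using h₂⟩
  | append_singleton L x ih =>
    cases L₂ with
    | nil => exact ⟨L ++ [x], [], [], by simp, by simp, by simpa using h₁⟩
    | cons y L' =>
      by_cases hxy : x.1 = y.1 → x.2 = y.2
      · refine ⟨L ++ [x], [], y :: L', by simp, by simp, ?_⟩
        refine List.isChain_append.2 ⟨h₁, h₂, ?_⟩
        simpa using hxy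
      · obtain ⟨a, p, b, rfl, rfl, hab⟩ :=
          ih L' (List.isChain_append.1 h₁).1 (List.IsChain.tail h₂)
        refine ⟨a, y :: p, b, ?_, by simp, hab⟩
        rw [invRev_cons, List.append_assoc]
        congr 2
        obtain ⟨x1, x2⟩ := x
        obtain ⟨y1, y2⟩ := y
        simp only [Classical.not_imp] at hxy
        obtain ⟨rfl, h⟩ := hxy
        cases x2 <;> cases y2 <;> simp_all [invRev]

theorem exists_toWord_mul (g h : FreeGroup α) :
    ∃ a p b, g.toWord = a ++ invRev p ∧ h.toWord = p ++ b ∧ (g * h).toWord = a ++ b := by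
  obtain ⟨a, p, b, hg, hh, hab⟩ :=
    exists_cancellation g.toWord h.toWord isReduced_toWord isReduced_toWord
  refine ⟨a, p, b, hg, hh, ?_⟩
  rw [← toWord_mk_of_isReduced hab]
  congr 1
  rw [← mk_toWord (x := g), ← mk_toWord (x := h), hg, hh, ← mul_mk, ← mul_mk, ← mul_mk, ← inv_mk]
  group

/-- The initial segments of the elements of a set. -/
def initialSegments (C : Set (FreeGroup α)) : Set (FreeGroup α) :=
  {u | ∃ c ∈ C, u.toWord <+: c.toWord}

theorem initialSegments_of_prefix {C : Set (FreeGroup α)} {u v : FreeGroup α}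
    (hv : v ∈ initialSegments C) (h : u.toWord <+: v.toWord) : u ∈ initialSegments C := by
  obtain ⟨c, hc, hvc⟩ := hv
  exact ⟨c, hc, h.trans hvc⟩

/-- The elements `u * v⁻¹`, without cancellation, where `u` and `v` are in `P`. -/
def reducedQuotients (P : Set (FreeGroup α)) : Set (FreeGroup α) :=
  {f | ∃ u ∈ P, ∃ v ∈ P, f = u * v⁻¹ ∧ f.norm = u.norm + v.norm}

theorem mem_reducedQuotients {C : Set (FreeGroup α)} {f c d : FreeGroup α}
    {p a : List (α × Bool)} (hf : f.toWord = p ++ invRev a) (hc : c ∈ C) (hd : d ∈ C)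
    (hp : p <+: c.toWord) (ha : a <+: d.toWord) :
    f ∈ reducedQuotients (initialSegments C) := by
  have hp' := toWord_mk_of_prefix hp
  have ha' := toWord_mk_of_prefix ha
  refine ⟨mk p, ⟨c, hc, by rwa [hp']⟩, mk a, ⟨d, hd, by rwa [ha']⟩, ?_, ?_⟩
  · rw [inv_mk, mul_mk, ← hf, mk_toWord]
  · simp [FreeGroup.norm, hf, hp', ha']

theorem exists_norm_pow_gt [Finite α] {c : FreeGroup α} (hc : c ≠ 1) (N : ℕ) :
    ∃ n : ℕ, N < (c ^ n).norm := by
  by_contra! h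
  have hinj : Function.Injective fun n : ℕ => c ^ n :=
    injective_pow_iff_not_isOfFinOrder.2 (not_isOfFinOrder_of_isMulTorsionFree hc)
  refine Set.infinite_range_of_injective hinj
    (((Set.finite_Iic N).biUnion fun k _ => sphere_finite (α := α) k).subset ?_)
  rintro _ ⟨n, rfl⟩
  simp only [Set.mem_iUnion]
  exact ⟨_, h n, rfl⟩

theorem generalizedNormalizer_subset [Finite α] (C : Subgroup (FreeGroup α)) :
    generalizedNormalizer C ⊆ reducedQuotients (initialSegments (C : Set (FreeGroup α))) := by
  intro f hf
  obtain ⟨⟨x, ⟨c, hc, hcx⟩, hxC⟩, hx1⟩ := Subgroup.ne_bot_iff_exists_ne_one.1 hf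
  replace hcx : f⁻¹ * c * f = x := by simpa using hcx
  have hc1 : c ≠ 1 := by
    rintro rfl
    apply hx1
    ext
    simp [← hcx]
  -- A power of `c` longer than `2 * f.norm` keeps the cancellations with `f⁻¹` on the left and `f`
  -- on the right from overlapping.
  obtain ⟨n, hn⟩ := exists_norm_pow_gt hc1 (2 * f.norm)
  have hdC : c ^ n ∈ C := pow_mem hc n
  have heC : f⁻¹ * c ^ n * f ∈ C := by
    have : f⁻¹ * c ^ n * f = x ^ n := by
      rw [← hcx]
      simpa using (conj_pow (i := n) (a := f⁻¹) (b := c)).symm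
    rw [this]
    exact pow_mem hxC n
  generalize c ^ n = d at hn hdC heC
  obtain ⟨a, p, b, hf1, hd1, hfd⟩ := exists_toWord_mul f⁻¹ d
  obtain ⟨a', p', b', hfd', hf2, he⟩ := exists_toWord_mul (f⁻¹ * d) f
  have hf3 : f.toWord = p ++ invRev a := by
    rw [← invRev_invRev (L₁ := f.toWord), ← toWord_inv, hf1, invRev_append, invRev_invRev]
  refine mem_reducedQuotients hf3 hdC heC ⟨b, hd1.symm⟩ ?_
  rw [hfd] at hfd'
  have hle : a <+: a' := by
    refine List.prefix_of_prefix_length_le ⟨b, rfl⟩ ⟨invRev p', hfd'.symm⟩ ?_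
    have e1 := congrArg List.length hfd'
    have e2 := congrArg List.length hf2
    have e3 := congrArg List.length hf3
    have e4 := congrArg List.length hd1
    simp only [List.length_append, invRev_length] at e1 e2 e3 e4
    simp only [FreeGroup.norm] at hn
    omega
  exact hle.trans ⟨b', he.symm⟩

theorem unstableReps_subset {C : Subgroup (FreeGroup α)} {S : Set (FreeGroup α)}
    (hS : IsSchreierTransversal C S) :
    unstableReps C S ⊆ reducedQuotients (initialSegments (C : Set (FreeGroup α))) := by
  rintro s ⟨hs, hst⟩
  obtain ⟨c, hc, hsc⟩ : ∃ c ∈ C, s * c ∉ S := by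
    by_contra! h
    exact hst ⟨hs, h⟩
  obtain ⟨a, p, b, hs1, hc1, hsc1⟩ := exists_toWord_mul s c
  have ha := toWord_mk_of_prefix (w := s) ⟨_, hs1.symm⟩
  have haS : mk a ∈ S := hS.mem_of_prefix s hs _ (by rw [ha]; exact ⟨_, hs1.symm⟩)
  obtain ⟨⟨⟨d, hd⟩, ⟨t, ht⟩⟩, hdt⟩ := hS.isComplement.2 (s * c)
  replace hdt : d * t = s * c := hdt
  obtain ⟨a₂, p₂, b₂, hd2, hw2, ht2⟩ := exists_toWord_mul d⁻¹ (s * c)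
  have htt : d⁻¹ * (s * c) = t := by rw [← hdt]; group
  rw [htt] at ht2
  have hd3 : d.toWord = p₂ ++ invRev a₂ := by
    rw [← invRev_invRev (L₁ := d.toWord), ← toWord_inv, hd2, invRev_append, invRev_invRev]
  rw [hsc1] at hw2
  -- Otherwise `a = p₂ ++ e`, and `a₂ ++ e` is an initial segment of `t`, hence in `S`. Since `d`
  -- carries it to `mk a ∈ S`, uniqueness of representatives forces `d = 1`, so `s * c = t ∈ S`.
  have key : a <+: p₂ := by
    refine (List.prefix_or_prefix_of_prefix ⟨b, rfl⟩ ⟨b₂, hw2.symm⟩).resolve_right ?_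
    rintro ⟨e, rfl⟩
    rw [List.append_assoc, List.append_cancel_left_eq] at hw2
    have hpre : a₂ ++ e <+: t.toWord := ⟨b, by rw [ht2, ← hw2, List.append_assoc]⟩
    have heS : mk (a₂ ++ e) ∈ S :=
      hS.mem_of_prefix t ht _ (by rwa [toWord_mk_of_prefix hpre])
    have hmk : d * mk (a₂ ++ e) = mk (p₂ ++ e) := by
      rw [← mk_toWord (x := d), hd3, ← mul_mk, ← mul_mk, ← mul_mk, ← inv_mk]
      group
    have := hS.isComplement.1 (a₁ := (⟨d, hd⟩, ⟨_, heS⟩)) (a₂ := (⟨1, one_mem C⟩, ⟨_, haS⟩))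
      (by simpa using hmk)
    have hd1 : d = 1 := by simpa using congrArg (fun z => (z.1 : FreeGroup α)) this
    rw [hd1, one_mul] at hdt
    exact hsc (hdt ▸ ht)
  have hainv : a <+: d.toWord := key.trans ⟨_, hd3.symm⟩
  exact mem_reducedQuotients hs1 hd hc hainv ⟨b, hc1.symm⟩

theorem prefix_toWord_mul {u g h : FreeGroup α} (hu : u.toWord <+: (g * h).toWord) :
    u.toWord <+: g.toWord ∨ ∃ v : FreeGroup α, v.toWord <+: h.toWord ∧ u = g * v := by
  obtain ⟨a, p, b, hg, hh, hgh⟩ := exists_toWord_mul g h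
  rw [hgh] at hu
  rcases List.prefix_or_prefix_of_prefix hu ⟨b, rfl⟩ with h1 | ⟨e, he⟩
  · exact Or.inl (h1.trans ⟨_, hg.symm⟩)
  · right
    rw [← he, List.prefix_append_right_inj] at hu
    have hpe : p ++ e <+: h.toWord := by rwa [hh, List.prefix_append_right_inj]
    refine ⟨mk (p ++ e), by rwa [toWord_mk_of_prefix hpe], ?_⟩
    rw [← mk_toWord (x := u), ← he, ← mk_toWord (x := g), hg, ← mul_mk, ← mul_mk, ← mul_mk,
      ← inv_mk]
    group

theorem prefix_toWord_inv {u g : FreeGroup α} (hu : u.toWord <+: g⁻¹.toWord) :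
    ∃ v : FreeGroup α, v.toWord <+: g.toWord ∧ u = g⁻¹ * v := by
  obtain ⟨e, he⟩ := hu
  have h2 : g.toWord = invRev e ++ invRev u.toWord := by
    rw [← invRev_append, he, toWord_inv, invRev_invRev]
  have hp : invRev e <+: g.toWord := ⟨_, h2.symm⟩
  refine ⟨mk (invRev e), by rwa [toWord_mk_of_prefix hp], ?_⟩
  rw [eq_inv_mul_iff_mul_eq]
  nth_rw 1 [← mk_toWord (x := g)]
  rw [h2, ← mul_mk, ← inv_mk, ← inv_mk, mk_toWord]
  group

theorem finite_prefixes (g : FreeGroup α) : {u : FreeGroup α | u.toWord <+: g.toWord}.Finite := by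
  refine Set.Finite.of_finite_image (f := toWord) ?_ toWord_injective.injOn
  refine (List.finite_toSet g.toWord.inits).subset ?_
  rintro _ ⟨u, hu, rfl⟩
  exact (List.mem_inits _ _).2 hu

open Pointwise in
-- Modulo `C` on the left, prefixes of products and inverses reduce to prefixes of the factors, so
-- prefixes of the generators, together with `1`, suffice for `B`.
theorem initialSegments_subset_mul_finite {C : Subgroup (FreeGroup α)} (hC : C.FG) :
    ∃ B : Finset (FreeGroup α),
      initialSegments (C : Set (FreeGroup α)) ⊆ (C : Set (FreeGroup α)) * B := by
  classical
  obtain ⟨T, rfl⟩ := hC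
  refine ⟨insert 1 (T.biUnion fun g => (finite_prefixes g).toFinset), ?_⟩
  rintro u ⟨c, hc, hu⟩
  replace hc : c ∈ Subgroup.closure (T : Set (FreeGroup α)) := hc
  have hmul : ∀ {x y : FreeGroup α} {B : Set (FreeGroup α)},
      x ∈ Subgroup.closure (T : Set (FreeGroup α)) →
      y ∈ (Subgroup.closure (T : Set (FreeGroup α)) : Set (FreeGroup α)) * B →
      x * y ∈ (Subgroup.closure (T : Set (FreeGroup α)) : Set (FreeGroup α)) * B := by
    rintro x _ B hx ⟨c, hc, b, hb, rfl⟩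
    exact ⟨x * c, mul_mem hx hc, b, hb, mul_assoc _ _ _⟩
  induction hc using Subgroup.closure_induction generalizing u with
  | mem g hg => exact ⟨1, one_mem _, u, by simpa using Or.inr ⟨g, hg, hu⟩, one_mul u⟩
  | one =>
    have : u = 1 := by simpa using hu
    exact ⟨1, one_mem _, 1, by simp, by simp [this]⟩
  | mul g h hg hh ihg ihh =>
    rcases prefix_toWord_mul hu with hu | ⟨v, hv, rfl⟩
    · exact ihg hu
    · exact hmul hg (ihh hv)
  | inv g hg ih =>
    obtain ⟨v, hv, rfl⟩ := prefix_toWord_inv hu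
    exact hmul (inv_mem hg) (ih hv)

end Words

/-! ### Counting reduced words and growth estimates. -/

section Growth

variable {α : Type*} [DecidableEq α]

/-- The words `t` of length `n` such that `x :: t` is reduced. -/
def extensions [Fintype α] : ℕ → α × Bool → Finset (List (α × Bool))
  | 0, _ => {[]}
  | n + 1, x => (Finset.univ.filter fun y : α × Bool => x.1 = y.1 → x.2 = y.2).biUnion
      fun y => (extensions n y).image (List.cons y)

theorem mem_extensions [Fintype α] {n : ℕ} {x : α × Bool} {t : List (α × Bool)} :
    t ∈ extensions n x ↔ IsReduced (x :: t) ∧ t.length = n := by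
  induction n generalizing x t with
  | zero =>
    constructor
    · intro h
      rw [extensions, Finset.mem_singleton] at h
      subst h
      exact ⟨List.IsChain.singleton _, rfl⟩
    · rintro ⟨-, h⟩
      simpa [extensions] using h
  | succ n ih =>
    cases t with
    | nil => simp [extensions]
    | cons z t =>
      have : IsReduced (x :: z :: t) ↔ (x.1 = z.1 → x.2 = z.2) ∧ IsReduced (z :: t) :=
        List.isChain_cons_cons
      rw [this, extensions, Finset.mem_biUnion, List.length_cons, Nat.add_right_cancel_iff]
      constructor
      · rintro ⟨y, hy, hyt⟩
        obtain ⟨t', ht', hyz⟩ := Finset.mem_image.1 hyt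
        obtain ⟨rfl, rfl⟩ := List.cons_eq_cons.1 hyz
        obtain ⟨h1, h2⟩ := ih.1 ht'
        exact ⟨⟨(Finset.mem_filter.1 hy).2, h1⟩, h2⟩
      · rintro ⟨⟨hxz, hzt⟩, ht⟩
        exact ⟨z, Finset.mem_filter.2 ⟨Finset.mem_univ _, hxz⟩,
          Finset.mem_image_of_mem _ (ih.2 ⟨hzt, ht⟩)⟩

theorem card_extensions [Fintype α] (n : ℕ) (x : α × Bool) :
    (extensions n x).card = (2 * Fintype.card α - 1) ^ n := by
  induction n generalizing x with
  | zero => simp [extensions]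
  | succ n ih =>
    have hfilter : (Finset.univ.filter fun y : α × Bool => x.1 = y.1 → x.2 = y.2) =
        Finset.univ.erase (x.1, !x.2) := by
      ext ⟨y1, y2⟩
      obtain ⟨x1, x2⟩ := x
      cases x2 <;> cases y2 <;> simp [Prod.ext_iff, @eq_comm _ x1 y1]
    rw [extensions, Finset.card_biUnion, Finset.sum_congr rfl fun y _ =>
      (Finset.card_image_of_injective _ List.cons_injective).trans (ih y), Finset.sum_const,
      hfilter, Finset.card_erase_of_mem (Finset.mem_univ _), Finset.card_univ, Fintype.card_prod,
      Fintype.card_bool, smul_eq_mul, pow_succ', mul_comm 2]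
    intro y _ z _ hyz
    refine Finset.disjoint_left.2 fun t hy hz => ?_
    obtain ⟨a, -, rfl⟩ := Finset.mem_image.1 hy
    obtain ⟨b, -, hb⟩ := Finset.mem_image.1 hz
    exact hyz (List.cons_eq_cons.1 hb).1.symm

theorem pow_le_ncard_sphere [Fintype α] [Nonempty α] (k : ℕ) :
    (2 * Fintype.card α - 1) ^ k ≤ (sphere α k).ncard := by
  obtain ⟨x⟩ := ‹Nonempty α›
  rw [← card_extensions k (x, true), ← Set.ncard_coe_finset]
  have hinj : Set.InjOn mk (extensions k (x, true) : Set (List (α × Bool))) := by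
    intro s hs t ht hst
    have hs' : IsReduced s := List.IsChain.tail (mem_extensions.1 hs).1
    have ht' : IsReduced t := List.IsChain.tail (mem_extensions.1 ht).1
    rw [← toWord_mk_of_isReduced hs', ← toWord_mk_of_isReduced ht']
    exact congrArg toWord hst
  rw [← hinj.ncard_image]
  refine Set.ncard_le_ncard ?_ (sphere_finite k)
  rintro _ ⟨t, ht, rfl⟩
  obtain ⟨h1, h2⟩ := mem_extensions.1 ht
  have h3 : IsReduced t := List.IsChain.tail h1
  simpa [sphere, FreeGroup.norm, h3.reduce_eq] using h2

theorem exists_append_singleton {w : FreeGroup α} (hw : w ≠ 1) :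
    ∃ l x, w.toWord = l ++ [x] := by
  have : w.toWord ≠ [] := by simpa using hw
  exact ⟨_, _, (List.dropLast_append_getLast this).symm⟩

/-- A prefix-closed set which every nontrivial element leaves by an extension of length `M`
loses at least one of the possible extensions in every `M` steps. -/
theorem ncard_inter_sphere_add_le [Fintype α] {P : Set (FreeGroup α)} {M : ℕ}
    (hP : ∀ v ∈ P, ∀ u : FreeGroup α, u.toWord <+: v.toWord → u ∈ P)
    (hM : ∀ w ∈ P, ∀ l x, w.toWord = l ++ [x] → ∃ t ∈ extensions M x, w * mk t ∉ P)
    {i : ℕ} (hi : 1 ≤ i) :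
    (P ∩ sphere α (i + M)).ncard ≤
      ((2 * Fintype.card α - 1) ^ M - 1) * (P ∩ sphere α i).ncard := by
  classical
  have hfin : (P ∩ sphere α i).Finite := (sphere_finite i).subset Set.inter_subset_right
  have hex : ∀ w : FreeGroup α, ∃ E : Finset (List (α × Bool)), w ∈ P ∩ sphere α i →
      E.card = (2 * Fintype.card α - 1) ^ M - 1 ∧ ∀ t, IsReduced (w.toWord ++ t) →
        t.length = M → w * mk t ∈ P → t ∈ E := by
    intro w
    by_cases hw : w ∈ P ∩ sphere α i
    swap
    · exact ⟨∅, fun h => absurd h hw⟩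
    have hw1 : w ≠ 1 := by
      rintro rfl
      have : 0 = i := by simpa [sphere] using hw.2
      omega
    obtain ⟨l, x, hx⟩ := exists_append_singleton hw1
    obtain ⟨t₀, ht₀, ht₀P⟩ := hM w hw.1 l x hx
    refine ⟨(extensions M x).erase t₀, fun _ => ⟨?_, fun t ht htM htP => ?_⟩⟩
    · rw [Finset.card_erase_of_mem ht₀, card_extensions]
    · refine Finset.mem_erase.2 ⟨?_, mem_extensions.2 ⟨?_, htM⟩⟩
      · rintro rfl
        exact ht₀P htP
      · rw [hx, List.append_assoc] at ht
        exact (List.isChain_append.1 ht).2.1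
  choose E hE using hex
  have hsub : P ∩ sphere α (i + M) ⊆
      (hfin.toFinset.biUnion fun w => (E w).image fun t => w * mk t : Finset (FreeGroup α)) := by
    rintro v ⟨hvP, hv⟩
    have hlen : v.toWord.length = i + M := hv
    have htake : v.toWord.take i <+: v.toWord := List.take_prefix _ _
    have hw := toWord_mk_of_prefix htake
    set w := mk (v.toWord.take i) with hwdef
    have hwP : w ∈ P := hP v hvP w (by rwa [hw])
    have hwi : w ∈ P ∩ sphere α i := by
      refine ⟨hwP, ?_⟩
      simp [sphere, FreeGroup.norm, hw, hlen]
    have hwv : w * mk (v.toWord.drop i) = v := by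
      rw [hwdef, mul_mk, List.take_append_drop, mk_toWord]
    rw [Finset.mem_coe, Finset.mem_biUnion]
    refine ⟨w, hfin.mem_toFinset.2 hwi, Finset.mem_image.2 ⟨v.toWord.drop i, ?_, hwv⟩⟩
    refine (hE w hwi).2 _ ?_ (by simp [hlen]) (by rwa [hwv])
    rw [hw, List.take_append_drop]
    exact isReduced_toWord
  refine (Set.ncard_le_ncard hsub (Finset.finite_toSet _)).trans ?_
  rw [Set.ncard_coe_finset, Set.ncard_eq_toFinset_card _ hfin, mul_comm]
  refine Finset.card_biUnion_le_card_mul _ _ _ fun w hw => Finset.card_image_le.trans ?_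
  exact ((hE w (hfin.mem_toFinset.1 hw)).1).le

theorem exists_geometric_bound {p : ℕ → ℕ} {q M : ℕ} (hq : 2 ≤ q) (hM : 1 ≤ M)
    (hp : ∀ i, 1 ≤ i → p (i + M) ≤ (q ^ M - 1) * p i) :
    ∃ K l : ℝ, 0 < K ∧ 0 < l ∧ l < q ∧ ∀ i, (p i : ℝ) ≤ K * l ^ i := by
  have hqM : 2 ≤ q ^ M := hq.trans (Nat.le_self_pow (by omega) q)
  have hpos : (0 : ℝ) < ((q ^ M - 1 : ℕ) : ℝ) := by
    exact_mod_cast (by omega : 0 < q ^ M - 1)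
  set l : ℝ := ((q ^ M - 1 : ℕ) : ℝ) ^ (1 / (M : ℝ)) with hl
  have hl0 : 0 < l := Real.rpow_pos_of_pos hpos _
  have hlM : l ^ M = ((q ^ M - 1 : ℕ) : ℝ) := by
    rw [hl, one_div, Real.rpow_inv_natCast_pow hpos.le (by omega)]
  -- The recursion starts at `i = 1`, so the base cases are `0, ..., M`; the `+ 1` keeps `K`
  -- positive.
  refine ⟨∑ j ∈ Finset.range (M + 1), (p j : ℝ) / l ^ j + 1, l, by positivity, hl0, ?_, ?_⟩
  · refine lt_of_pow_lt_pow_left₀ M (by positivity) ?_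
    rw [hlM]
    exact_mod_cast (by omega : q ^ M - 1 < q ^ M)
  · intro i
    induction i using Nat.strong_induction_on with
    | _ i ih =>
      by_cases hi : i ≤ M
      · rw [← div_le_iff₀ (by positivity)]
        have := Finset.single_le_sum (f := fun j => (p j : ℝ) / l ^ j)
          (fun j _ => by positivity) (Finset.mem_range.2 (Nat.lt_succ_of_le hi))
        linarith
      · obtain ⟨j, rfl⟩ : ∃ j, i = j + M := ⟨i - M, by omega⟩
        have h1 : (p (j + M) : ℝ) ≤ l ^ M * p j := by
          rw [hlM]
          exact_mod_cast hp j (by omega)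
        refine h1.trans ?_
        calc l ^ M * (p j : ℝ) ≤ l ^ M * (_ * l ^ j) := by
              gcongr
              exact ih j (by omega)
          _ = _ := by rw [pow_add]; ring

theorem ncard_reducedQuotients_inter_sphere_le [Finite α] (P : Set (FreeGroup α)) (k : ℕ) :
    (reducedQuotients P ∩ sphere α k).ncard ≤
      ∑ ij ∈ Finset.HasAntidiagonal.antidiagonal k,
        (P ∩ sphere α ij.1).ncard * (P ∩ sphere α ij.2).ncard := by
  classical
  have hfin : ∀ i, (P ∩ sphere α i).Finite :=
    fun i => (sphere_finite i).subset Set.inter_subset_right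
  have hsub : reducedQuotients P ∩ sphere α k ⊆
      ((Finset.HasAntidiagonal.antidiagonal k).biUnion fun ij =>
      ((hfin ij.1).toFinset ×ˢ (hfin ij.2).toFinset).image
        fun uv => uv.1 * uv.2⁻¹ : Finset (FreeGroup α)) := by
    rintro f ⟨⟨u, hu, v, hv, rfl, hn⟩, hf⟩
    rw [Finset.mem_coe, Finset.mem_biUnion]
    refine ⟨(u.norm, v.norm), Finset.HasAntidiagonal.mem_antidiagonal.2 (hn.symm.trans hf),
      Finset.mem_image.2 ⟨(u, v), ?_, rfl⟩⟩
    simp [hu, hv, sphere]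
  refine (Set.ncard_le_ncard hsub (Finset.finite_toSet _)).trans ?_
  rw [Set.ncard_coe_finset]
  refine Finset.card_biUnion_le.trans (Finset.sum_le_sum fun ij _ => Finset.card_image_le.trans ?_)
  rw [Finset.card_product, Set.ncard_eq_toFinset_card _ (hfin ij.1),
    Set.ncard_eq_toFinset_card _ (hfin ij.2)]

open Filter Topology in
theorem exponentiallyNegligible_reducedQuotients [Fintype α] [Nonempty α] {P : Set (FreeGroup α)}
    {K l : ℝ} (hK : 0 < K) (hl : 0 < l) (hlq : l < (2 * Fintype.card α - 1 : ℕ))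
    (hP : ∀ i, ((P ∩ sphere α i).ncard : ℝ) ≤ K * l ^ i) :
    ExponentiallyNegligible (reducedQuotients P) := by
  set q : ℝ := ((2 * Fintype.card α - 1 : ℕ) : ℝ) with hq
  have hq0 : 0 < q := hl.trans hlq
  -- The gap between `l / q` and `δ` absorbs the factor `(k + 1) * K ^ 2`.
  obtain ⟨δ, hδ, hδ1⟩ := exists_between ((div_lt_one hq0).2 hlq)
  have hδ0 : 0 < δ := (div_pos hl hq0).trans hδ
  refine ⟨δ, hδ0, hδ1, ?_⟩
  have hρ0 : 0 < l / q / δ := by positivity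
  have hρ1 : l / q / δ < 1 := (div_lt_one hδ0).2 hδ
  have hlim : Tendsto (fun k : ℕ => K ^ 2 * (k * (l / q / δ) ^ k + (l / q / δ) ^ k)) atTop
      (𝓝 (K ^ 2 * (0 + 0))) :=
    ((tendsto_self_mul_const_pow_of_lt_one hρ0.le hρ1).add
      (tendsto_pow_atTop_nhds_zero_of_lt_one hρ0.le hρ1)).const_mul _
  filter_upwards [hlim.eventually_lt_const (by norm_num : K ^ 2 * (0 + 0) < 1)] with k hk
  have hnum : ((reducedQuotients P ∩ sphere α k).ncard : ℝ) ≤ (k + 1) * (K ^ 2 * l ^ k) := by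
    calc ((reducedQuotients P ∩ sphere α k).ncard : ℝ)
        ≤ ∑ ij ∈ Finset.HasAntidiagonal.antidiagonal k,
            ((P ∩ sphere α ij.1).ncard : ℝ) * (P ∩ sphere α ij.2).ncard := by
          exact_mod_cast ncard_reducedQuotients_inter_sphere_le P k
      _ ≤ ∑ ij ∈ Finset.HasAntidiagonal.antidiagonal k, K ^ 2 * l ^ k := by
          refine Finset.sum_le_sum fun ij hij => ?_
          rw [← Finset.HasAntidiagonal.mem_antidiagonal.1 hij, pow_add]
          calc _ ≤ (K * l ^ ij.1) * (K * l ^ ij.2) :=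
                mul_le_mul (hP _) (hP _) (by positivity) (by positivity)
            _ = _ := by ring
      _ = (k + 1) * (K ^ 2 * l ^ k) := by simp
  have hden : q ^ k ≤ ((sphere α k).ncard : ℝ) := by
    rw [hq]
    exact_mod_cast pow_le_ncard_sphere (α := α) k
  calc freq (reducedQuotients P) k ≤ (k + 1) * (K ^ 2 * l ^ k) / q ^ k :=
        div_le_div₀ (by positivity) hnum (by positivity) hden
    _ = K ^ 2 * (k * (l / q / δ) ^ k + (l / q / δ) ^ k) * δ ^ k := by
        rw [div_pow, div_pow]
        field_simp
    _ < δ ^ k := by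
        have := pow_pos hδ0 k
        nlinarith

theorem ExponentiallyNegligible.mono [Finite α] {R T : Set (FreeGroup α)}
    (hT : ExponentiallyNegligible T) (h : R ⊆ T) : ExponentiallyNegligible R := by
  obtain ⟨δ, h0, h1, hδ⟩ := hT
  refine ⟨δ, h0, h1, hδ.mono fun k hk => lt_of_le_of_lt ?_ hk⟩
  unfold freq
  gcongr
  exact (sphere_finite k).subset Set.inter_subset_right

theorem exponentiallyNegligible_empty : ExponentiallyNegligible (∅ : Set (FreeGroup α)) :=
  ⟨1 / 2, by norm_num, by norm_num, Filter.Eventually.of_forall fun k => by simp [freq]⟩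

end Growth

/-! ### Escaping from `P` when the index is infinite. -/

section InfiniteIndex

variable {α : Type*} [DecidableEq α]

open Pointwise in
-- For a letter `y` other than `x.1`, either `g` or `y * g` can follow `x`. Without an escape, two
-- translates of `C * B` would cover the group; these are finitely many left cosets of conjugates of
-- `C`, one of which would have finite index.
theorem exists_reduced_extension_notMem [Nontrivial α] {C : Subgroup (FreeGroup α)}
    (hC : ¬ C.FiniteIndex) (B : Finset (FreeGroup α)) (b : FreeGroup α) (x : α × Bool) :
    ∃ t : FreeGroup α, IsReduced (x :: t.toWord) ∧ b * t ∉ (C : Set (FreeGroup α)) * B := by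
  classical
  by_contra! h
  obtain ⟨y, hy⟩ := exists_ne x.1
  have hcover : ⋃ i ∈ ({b⁻¹, (of y)⁻¹ * b⁻¹} : Finset (FreeGroup α)) ×ˢ B,
      (i.1 * i.2) • ((C.map (MulAut.conj i.2⁻¹).toMonoidHom : Subgroup (FreeGroup α)) :
        Set (FreeGroup α)) = Set.univ := by
    have key : ∀ z g : FreeGroup α, z ∈ ({b⁻¹, (of y)⁻¹ * b⁻¹} : Finset (FreeGroup α)) →
        z⁻¹ * g ∈ (C : Set (FreeGroup α)) * B →
        g ∈ ⋃ i ∈ ({b⁻¹, (of y)⁻¹ * b⁻¹} : Finset (FreeGroup α)) ×ˢ B,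
          (i.1 * i.2) • ((C.map (MulAut.conj i.2⁻¹).toMonoidHom : Subgroup (FreeGroup α)) :
            Set (FreeGroup α)) := by
      rintro z g hz ⟨c, hc, b', hb', hcb⟩
      rw [Set.mem_iUnion₂]
      refine ⟨(z, b'), Finset.mem_product.2 ⟨hz, hb'⟩, b'⁻¹ * c * b', ⟨c, hc, by simp⟩, ?_⟩
      have hcb' : c * b' = z⁻¹ * g := hcb
      change z * b' * (b'⁻¹ * c * b') = g
      rw [show z * b' * (b'⁻¹ * c * b') = z * (c * b') by group, hcb']
      group
    refine Set.eq_univ_of_forall fun g => ?_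
    by_cases hg : IsReduced (x :: g.toWord)
    · exact key b⁻¹ g (by simp) (by simpa using h g hg)
    · refine key ((of y)⁻¹ * b⁻¹) g (by simp) ?_
      have hyg : IsReduced ((y, true) :: g.toWord) := by
        cases hgw : g.toWord with
        | nil => exact List.IsChain.singleton _
        | cons z t =>
          have hzt : IsReduced (z :: t) := hgw ▸ isReduced_toWord
          refine List.isChain_cons_cons.2 ⟨fun hyz => ?_, hzt⟩
          refine absurd (List.isChain_cons_cons.2 ⟨fun hxz => ?_, hzt⟩) (hgw ▸ hg)
          exact absurd (hyz.trans hxz.symm) hy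
      have hyg' : (of y * g).toWord = (y, true) :: g.toWord := by
        rw [← toWord_mk_of_isReduced hyg]
        congr 1
        nth_rw 1 [← mk_toWord (x := g)]
        rfl
      have := h (of y * g) (by
        rw [hyg']
        exact List.isChain_cons_cons.2 ⟨fun hxy => absurd hxy.symm hy, hyg⟩)
      simpa [mul_assoc] using this
  obtain ⟨i, -, hi⟩ := Subgroup.exists_finiteIndex_of_leftCoset_cover hcover
  refine hC ⟨?_⟩
  have := hi.index_ne_zero
  rwa [show (C.map (MulAut.conj i.2⁻¹).toMonoidHom).index = C.index from
    Subgroup.index_map_equiv C (MulAut.conj i.2⁻¹)] at this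

theorem exists_uniform_extension_notMem [Fintype α] [Nontrivial α] {C : Subgroup (FreeGroup α)}
    (hfg : C.FG) (hC : ¬ C.FiniteIndex) :
    ∃ M, 1 ≤ M ∧ ∀ w ∈ initialSegments (C : Set (FreeGroup α)), ∀ l x, w.toWord = l ++ [x] →
      ∃ t ∈ extensions M x, w * mk t ∉ initialSegments (C : Set (FreeGroup α)) := by
  obtain ⟨B, hB⟩ := initialSegments_subset_mul_finite hfg
  choose t htr htn using fun b x => exists_reduced_extension_notMem hC B b x
  -- Writing `w = c * b`, the escape depends only on `b` and the last letter `x`: finitely many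
  -- cases.
  refine ⟨(B ×ˢ Finset.univ).sup (fun bx => (t bx.1 bx.2).norm) + 1, by omega, ?_⟩
  set M := (B ×ˢ Finset.univ).sup (fun bx => (t bx.1 bx.2).norm)
  intro w hw l x hwx
  obtain ⟨c, hc, b, hb, hcb⟩ := hB hw
  replace hcb : c * b = w := hcb
  have hle : (t b x).norm ≤ M :=
    Finset.le_sup (f := fun bx : FreeGroup α × (α × Bool) => (t bx.1 bx.2).norm)
      (b := (b, x)) (Finset.mem_product.2 ⟨hb, Finset.mem_univ x⟩)
  have hw_mul : w * t b x ∉ initialSegments (C : Set (FreeGroup α)) := by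
    intro hmem
    obtain ⟨c', hc', b', hb', hcb'⟩ := hB hmem
    refine htn b x ⟨c⁻¹ * c', mul_mem (inv_mem hc) hc', b', hb', ?_⟩
    have : c' * b' = w * t b x := hcb'
    change c⁻¹ * c' * b' = b * t b x
    rw [mul_assoc, this, ← hcb]
    group
  obtain ⟨u, z, hz⟩ : ∃ u z, x :: (t b x).toWord = u ++ [z] :=
    ⟨_, _, (List.dropLast_append_getLast (List.cons_ne_nil _ _)).symm⟩
  -- Padding to the exact common length is harmless, because `P` is closed under prefixes.
  obtain ⟨s, hs⟩ : (extensions (M + 1 - (t b x).norm) z).Nonempty := by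
    rw [← Finset.card_pos, card_extensions]
    have := Fintype.card_pos (α := α)
    exact pow_pos (by omega) _
  obtain ⟨hs1, hs2⟩ := mem_extensions.1 hs
  have hred : IsReduced (x :: ((t b x).toWord ++ s)) := by
    rw [← List.cons_append, hz, List.append_assoc]
    exact List.isChain_split.2 ⟨hz ▸ htr b x, hs1⟩
  refine ⟨(t b x).toWord ++ s, mem_extensions.2 ⟨hred, ?_⟩, fun hmem => hw_mul ?_⟩
  · have : (t b x).toWord.length = (t b x).norm := rfl
    rw [List.length_append, hs2, this]
    omega
  · have hwr : IsReduced (l ++ [x]) := hwx ▸ isReduced_toWord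
    have hall : IsReduced (w.toWord ++ ((t b x).toWord ++ s)) := by
      rw [hwx, List.append_assoc]
      exact List.isChain_split.2 ⟨hwr, hred⟩
    refine initialSegments_of_prefix hmem ?_
    have h1 : (w * mk ((t b x).toWord ++ s)).toWord = w.toWord ++ ((t b x).toWord ++ s) := by
      rw [← toWord_mk_of_isReduced hall, ← mul_mk (L₁ := w.toWord), mk_toWord]
    have h2 : (w * t b x).toWord = w.toWord ++ (t b x).toWord := by
      have : IsReduced (w.toWord ++ (t b x).toWord) :=
        List.IsChain.prefix hall ⟨s, by rw [List.append_assoc]⟩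
      rw [← toWord_mk_of_isReduced this, ← mul_mk, mk_toWord, mk_toWord]
    rw [h1, h2]
    exact ⟨s, by rw [List.append_assoc]⟩

theorem exponentiallyNegligible_reducedQuotients_initialSegments [Finite α] [Nontrivial α]
    {C : Subgroup (FreeGroup α)} (hfg : C.FG) (hC : ¬ C.FiniteIndex) :
    ExponentiallyNegligible (reducedQuotients (initialSegments (C : Set (FreeGroup α)))) := by
  have := Fintype.ofFinite α
  obtain ⟨M, hM, hext⟩ := exists_uniform_extension_notMem hfg hC
  have hcard := Fintype.one_lt_card (α := α)
  obtain ⟨K, l, hK, hl, hlq, hbound⟩ :=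
    exists_geometric_bound
      (p := fun i => (initialSegments (C : Set (FreeGroup α)) ∩ sphere α i).ncard)
      (by omega : 2 ≤ 2 * Fintype.card α - 1) hM fun i hi =>
      ncard_inter_sphere_add_le (fun v hv u hu => initialSegments_of_prefix hv hu) hext hi
  exact exponentiallyNegligible_reducedQuotients hK hl hlq hbound

omit [DecidableEq α] in
theorem eq_bot_of_not_finiteIndex_of_subsingleton [Subsingleton α] {C : Subgroup (FreeGroup α)}
    (hC : ¬ C.FiniteIndex) : C = ⊥ := by
  by_contra hne
  apply hC
  cases isEmpty_or_nonempty α with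
  | inl h => infer_instance
  | inr h =>
    let : Unique α := Classical.choice ((unique_iff_subsingleton_and_nonempty α).2 ⟨‹_›, h⟩)
    obtain ⟨⟨c, hc⟩, hc1⟩ := Subgroup.ne_bot_iff_exists_ne_one.1 hne
    replace hc1 : c ≠ 1 := fun h => hc1 (Subtype.ext h)
    have : IsCyclic (FreeGroup α) :=
      isCyclic_of_surjective (mulEquivIntOfUnique (α := α)).symm (MulEquiv.surjective _)
    obtain ⟨g, hg⟩ := IsCyclic.exists_generator (α := FreeGroup α)
    obtain ⟨n, rfl⟩ := Subgroup.mem_zpowers_iff.1 (hg c)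
    have hn : n ≠ 0 := by
      rintro rfl
      exact hc1 (zpow_zero g)
    refine Subgroup.finiteIndex_of_leftCoset_cover_const (s := Finset.range n.natAbs)
      (g := fun i => g ^ i) (Set.eq_univ_of_forall fun x => ?_)
    obtain ⟨m, rfl⟩ := Subgroup.mem_zpowers_iff.1 (hg x)
    have h0 := Int.emod_nonneg m hn
    have h1 := Int.emod_lt m hn
    rw [Set.mem_iUnion₂]
    refine ⟨(m % n).toNat, Finset.mem_range.2 (by omega), (g ^ n) ^ (m / n), zpow_mem hc _, ?_⟩
    change g ^ (m % n).toNat * (g ^ n) ^ (m / n) = g ^ m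
    rw [← zpow_natCast, Int.toNat_of_nonneg h0, ← zpow_mul, ← zpow_add, Int.emod_add_mul_ediv]

end InfiniteIndex

end FreeGroupDensity

theorem mainTheorem1 {α : Type*} [Finite α] [DecidableEq α]
    (C : Subgroup (FreeGroup α)) (hfg : C.FG) (hindex : ¬ C.FiniteIndex) :
    FreeGroupDensity.ExponentiallyNegligible (FreeGroupDensity.generalizedNormalizer C) ∧
    ∀ S : Set (FreeGroup α), FreeGroupDensity.IsSchreierTransversal C S →
      FreeGroupDensity.ExponentiallyNegligible (FreeGroupDensity.singularReps C S) ∧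
      FreeGroupDensity.ExponentiallyNegligible (FreeGroupDensity.unstableReps C S) := by
  open FreeGroupDensity in
  rcases subsingleton_or_nontrivial α with hα | hα
  -- The group is trivial or infinite cyclic, so infinite index forces `C = ⊥`, and all the sets in
  -- question are empty.
  · obtain rfl := eq_bot_of_not_finiteIndex_of_subsingleton hindex
    have hN : generalizedNormalizer (⊥ : Subgroup (FreeGroup α)) = ∅ := by
      simp [generalizedNormalizer]
    refine ⟨hN ▸ exponentiallyNegligible_empty, fun S _ => ⟨?_, ?_⟩⟩
    · simpa [singularReps, hN] using exponentiallyNegligible_empty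
    · have : unstableReps (⊥ : Subgroup (FreeGroup α)) S = ∅ := by
        simp [unstableReps, stableReps]
      exact this ▸ exponentiallyNegligible_empty
  · have h := exponentiallyNegligible_reducedQuotients_initialSegments hfg hindex
    exact ⟨h.mono (generalizedNormalizer_subset C), fun S hS =>
      ⟨h.mono fun s hs => generalizedNormalizer_subset C hs.2, h.mono (unstableReps_subset hS)⟩⟩
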